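/- **Fusion algebras.** A fusion algebra $(R,d)$ consists of a set $I$ (the irreducible objects) with a distinguished element $e$ and an involution $\alpha\mapsto\bar\alpha$, a unital ring structure on $R=\mathbb Z[I]$ with unit $e$ and products $\xi\eta=\sum_\alpha N_{\xi,\eta}^\alpha\,\alpha$, where the $N_{\xi,\eta}^\alpha$ are non-negative integers, finitely many of them non-zero for given $\xi,\eta$, and a ring homomorphism $d\colon R\to\mathbb R$. It is required that the involution extends to an antimultiplicative map of $R$, that $N_{\xi,\eta}^\alpha=N_{\alpha,\bar\eta}^\xi=N_{\bar\xi,\alpha}^\eta$, and that $d(\bar\alpha)=d(\alpha)\ge 1$ for $\alpha\in I$. A finite set $X\subseteq I$ is *generating* if $\overline X=X$ and every $\alpha\in I$ occurs with non-zero coefficient in some product $x_1\cdots x_n$ with $n\ge 1$ and $x_1,\dots,x_n\in X$. **Kazhdan constants.** Let $\mathcal C_R=\mathbb C[I]$ be the complexification of $R$, a unital $*$-algebra. Let $\pi\colon\mathcal C_R\to B(H)$ be a unital $*$-representation without non-zero invariant vectors, i.e. with $\mathrm{Fix}(\pi)=\{\xi\in H:\pi(\alpha)\xi=d(\alpha)\xi\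 \ \forall\alpha\in I\}=\{0\}$. Put $$\mathrm{Kaz}(\pi,(R,d))=\inf_{X}\ \inf_{\xi\in H,\ \|\xi\|=1}\ \max_{\alpha\in X}\ \frac{\|\pi(\alpha)\xi-d(\alpha)\xi\|}{d(\alpha)},$$ where $X$ runs over the finite generating subsets of $I$. The right regular representation $\rho\colon\mathcal C_R\to B(\ell^2(I))$ is determined by $\rho(\alpha)\delta_\beta=\sum_{\eta\in I}N_{\beta,\bar\alpha}^{\eta}\,\delta_\eta$ for $\alpha,\beta\in I$. **The fusion algebra of $SO_q(3)$.** Let $q\in(0,1]$, and let $[n]_q=\frac{q^{-n}-q^{n}}{q^{-1}-q}$ if $q<1$ and $[n]_1=n$. Let $R(SO_q(3))$ be the fusion algebra of the finite-dimensional representations of the quantum group $SO_q(3)$, equipped with the quantum dimension. Explicitly, $I=\{0,1,2,\dots\}$, $e=0$, $\bar n=n$, $$m\otimes n=|m-n|\oplus(|m-n|+1)\oplus\cdots\oplus(m+n),\qquad d(n)=[2n+1]_q .$$ **Proposition.** For every $q\in(0,1]$ the representation $\rho$ of $\mathcal C_{R(SO_q(3))}$ has no non-zero invariant vectors, and $$\mathrm{Kaz}\bigl(\rho,R(SO_q(3))\bigr)=1-\frac{3}{[3]_q}=1-\frac{3}{q^2+q^{-2}+1}.$$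 -/

import Mathlib

open scoped BigOperators ENNReal InnerProductSpace

noncomputable section

/-- A fusion algebra `(R, d)` with set `I` of irreducible objects. The ring structure on `ℤ[I]` is
given by its structure constants: `fusion ξ η α` is the coefficient `N_{ξ,η}^α` of `α` in the
product `ξ η`; the actual ring is `FusionAlgebra.Alg F ℤ` below. -/
structure FusionAlgebra (I : Type*) where
  /-- the distinguished element `e` -/
  e : I
  /-- the involution on irreducible objects -/
  conj : I → I
  /-- `fusion ξ η α = N_{ξ,η}^α`, nonzero for finitely many `α` only -/
  fusion : I → I → I →₀ ℕ
  /-- the dimension function on irreducible objects -/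
  d : I → ℝ
  e_mul : ∀ a, fusion e a = Finsupp.single a 1
  mul_e : ∀ a, fusion a e = Finsupp.single a 1
  assoc : ∀ a b c x, ((fusion a b).sum fun y n => n * fusion y c x) =
    (fusion b c).sum fun y n => n * fusion a y x
  conj_conj : ∀ a, conj (conj a) = a
  conj_mul : ∀ a b x, fusion (conj b) (conj a) (conj x) = fusion a b x
  frobenius_right : ∀ a b x, fusion a b x = fusion x (conj b) a
  frobenius_left : ∀ a b x, fusion a b x = fusion (conj a) x b
  d_conj : ∀ a, d (conj a) = d a
  one_le_d : ∀ a, 1 ≤ d a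
  d_mul : ∀ a b, d a * d b = (fusion a b).sum fun x n => (n : ℝ) * d x

namespace FusionAlgebra

variable {I : Type*} (F : FusionAlgebra I)

/-- The fusion algebra with coefficients in `k`, with underlying module `k[I]`:
`F.Alg ℤ` is the ring `R = ℤ[I]`, and `F.Alg ℂ` is its complexification `C_R`. -/
def Alg (_F : FusionAlgebra I) (k : Type*) [CommRing k] : Type _ := I →₀ k

section Algebra

variable (k : Type*) [CommRing k]

instance : AddCommGroup (F.Alg k) := inferInstanceAs (AddCommGroup (I →₀ k))
instance : Module k (F.Alg k) := inferInstanceAs (Module k (I →₀ k))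

/-- The basis element of `k[I]` attached to `a : I`. -/
def basis (a : I) : F.Alg k := (Finsupp.single a 1 : I →₀ k)

/-- The product of two irreducible objects, `∑ α, N_{a,b}^α α`, as an element of `k[I]`. -/
def prod (a b : I) : F.Alg k :=
  ((F.fusion a b).mapRange (Nat.cast : ℕ → k) Nat.cast_zero : I →₀ k)

/-- The multiplication of `k[I]`: the bilinear extension of `prod`. -/
def mulMap : F.Alg k →ₗ[k] F.Alg k →ₗ[k] F.Alg k :=
  Finsupp.linearCombination k (M := F.Alg k →ₗ[k] F.Alg k)
    (fun a => Finsupp.linearCombination k (M := F.Alg k) (fun b => F.prod k a b))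

instance : Mul (F.Alg k) := ⟨fun x y => F.mulMap k x y⟩
instance : One (F.Alg k) := ⟨F.basis k F.e⟩

variable {k}

theorem mul_def (x y : F.Alg k) : x * y = F.mulMap k x y := rfl

theorem basis_mul_basis (a b : I) : F.basis k a * F.basis k b = F.prod k a b := by
  rw [mul_def]
  unfold mulMap basis
  erw [Finsupp.linearCombination_single, one_smul, Finsupp.linearCombination_single, one_smul]

theorem alg_hom_ext {M : Type*} [AddCommGroup M] [Module k M] {f g : F.Alg k →ₗ[k] M}
    (h : ∀ a, f (F.basis k a) = g (F.basis k a)) : f = g := by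
  refine Finsupp.lhom_ext' (M := k) (R := k) fun a => LinearMap.ext_ring ?_
  exact h a

/-- The coefficient of an element of `k[I]` at `a : I`. -/
def coeff (a : I) : F.Alg k →ₗ[k] k := (Finsupp.lapply a : (I →₀ k) →ₗ[k] k)

theorem alg_ext {x y : F.Alg k} (h : ∀ a, F.coeff a x = F.coeff a y) : x = y :=
  Finsupp.ext (M := k) h

theorem coeff_basis [DecidableEq I] (a b : I) :
    F.coeff b (F.basis k a) = if a = b then 1 else 0 :=
  Finsupp.single_apply

theorem coeff_prod (a b x : I) : F.coeff x (F.prod k a b) = (F.fusion a b x : k) :=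
  Finsupp.mapRange_apply (hf := Nat.cast_zero) ..

/-- The linear extension to `k[I]` of a function on `I`. -/
def lift {M : Type*} [AddCommGroup M] [Module k M] (f : I → M) : F.Alg k →ₗ[k] M :=
  (Finsupp.linearCombination k f : (I →₀ k) →ₗ[k] M)

theorem lift_basis {M : Type*} [AddCommGroup M] [Module k M] (f : I → M) (a : I) :
    F.lift f (F.basis k a) = f a := by
  unfold lift basis
  erw [Finsupp.linearCombination_single, one_smul]

theorem prod_eq_sum (a b : I) :
    F.prod k a b = (F.fusion a b).sum fun y n => (n : k) • F.basis k y := by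
  classical
  refine F.alg_ext fun x => ?_
  rw [coeff_prod, Finsupp.sum, map_sum]
  simp only [map_smul, coeff_basis, smul_eq_mul, mul_ite, mul_one, mul_zero]
  rw [Finset.sum_ite_eq']
  split_ifs with h
  · rfl
  · simp [Finsupp.notMem_support_iff.1 h]

theorem prod_mul_basis (a b c : I) :
    F.prod k a b * F.basis k c = F.basis k a * F.prod k b c := by
  refine F.alg_ext fun x => ?_
  rw [prod_eq_sum, prod_eq_sum, mul_def, mul_def, Finsupp.sum, Finsupp.sum, map_sum, map_sum,
    LinearMap.sum_apply, map_sum, map_sum]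
  simp only [map_smul, LinearMap.smul_apply, ← mul_def, basis_mul_basis, coeff_prod, smul_eq_mul]
  have h := congrArg (Nat.cast : ℕ → k) (F.assoc a b c x)
  simpa [Finsupp.sum] using h

theorem alg_induction {p : F.Alg k → Prop} (x : F.Alg k) (h0 : p 0)
    (hadd : ∀ x y, p x → p y → p (x + y)) (hb : ∀ (r : k) a, p (r • F.basis k a)) : p x := by
  refine Finsupp.induction_linear (motive := p) x h0 hadd fun a r => ?_
  have h := hb r a
  unfold basis at h
  erw [Finsupp.smul_single] at h
  simpa using h

theorem smul_mul (r : k) (x y : F.Alg k) : (r • x) * y = r • (x * y) := by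
  simp [mul_def]

theorem mul_smul' (r : k) (x y : F.Alg k) : x * (r • y) = r • (x * y) := by
  simp [mul_def]

instance : NonUnitalNonAssocRing (F.Alg k) :=
  { (inferInstance : AddCommGroup (F.Alg k)) with
    mul := fun x y => F.mulMap k x y
    left_distrib := fun x y z => (F.mulMap k x).map_add y z
    right_distrib := fun x y z => LinearMap.map_add₂ (F.mulMap k) x y z
    zero_mul := fun x => LinearMap.map_zero₂ (F.mulMap k) x
    mul_zero := fun x => (F.mulMap k x).map_zero }

instance : Ring (F.Alg k) :=
  { (inferInstance : NonUnitalNonAssocRing (F.Alg k)) with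
    one := F.basis k F.e
    mul_assoc := fun x y z => by
      refine F.alg_induction (p := fun x => x * y * z = x * (y * z)) x (by simp)
        (fun x x' h h' => by simp [add_mul, h, h']) fun r a => ?_
      refine F.alg_induction (p := fun y => r • F.basis k a * y * z = r • F.basis k a * (y * z))
        y (by simp) (fun x x' h h' => by simp [add_mul, mul_add, h, h']) fun s b => ?_
      refine F.alg_induction (p := fun z => r • F.basis k a * s • F.basis k b * z =
        r • F.basis k a * (s • F.basis k b * z))
        z (by simp) (fun x x' h h' => by simp [mul_add, h, h']) fun t c => ?_
      simp only [smul_mul, mul_smul', basis_mul_basis, prod_mul_basis]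
    one_mul := fun x => by
      have h : F.mulMap k (F.basis k F.e) = LinearMap.id := by
        refine F.alg_hom_ext fun a => ?_
        rw [← mul_def, basis_mul_basis, prod_eq_sum, e_mul]
        simp
      exact congrArg (fun f => f x) h
    mul_one := fun x => by
      have h : (F.mulMap k).flip (F.basis k F.e) = LinearMap.id := by
        refine F.alg_hom_ext fun a => ?_
        rw [LinearMap.flip_apply, ← mul_def, basis_mul_basis, prod_eq_sum, mul_e]
        simp
      exact congrArg (fun f => f x) h }

instance : Algebra k (F.Alg k) :=
  Algebra.ofModule F.smul_mul F.mul_smul'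

theorem one_def : (1 : F.Alg k) = F.basis k F.e := rfl

/-- The involution of `k[I]`: the conjugate-linear extension of `conj`. -/
instance [StarRing k] : Star (F.Alg k) :=
  ⟨fun x => Finsupp.mapDomain F.conj
    (Finsupp.mapRange (star : k → k) (star_zero k) (x : I →₀ k))⟩

theorem conj_injective : Function.Injective F.conj :=
  Function.Involutive.injective F.conj_conj

theorem coeff_star [StarRing k] (x : F.Alg k) (a : I) :
    F.coeff a (star x) = star (F.coeff (F.conj a) x) := by
  have h := Finsupp.mapDomain_apply F.conj_injective
    (Finsupp.mapRange (star : k → k) (star_zero k) (x : I →₀ k)) (F.conj a)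
  rw [F.conj_conj] at h
  exact h.trans (Finsupp.mapRange_apply (hf := star_zero k) ..)

theorem star_basis [StarRing k] (a : I) : star (F.basis k a) = F.basis k (F.conj a) := by
  classical
  refine F.alg_ext fun x => ?_
  rw [coeff_star, coeff_basis, coeff_basis]
  have : a = F.conj x ↔ F.conj a = x :=
    ⟨fun h => by rw [h, F.conj_conj], fun h => by rw [← h, F.conj_conj]⟩
  simp only [this]
  split_ifs <;> simp

theorem star_add' [StarRing k] (x y : F.Alg k) : star (x + y) = star x + star y :=
  F.alg_ext fun a => by simp [coeff_star]

theorem star_smul' [StarRing k] (r : k) (x : F.Alg k) : star (r • x) = star r • star x :=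
  F.alg_ext fun a => by simp [coeff_star]

theorem star_zero' [StarRing k] : star (0 : F.Alg k) = 0 :=
  F.alg_ext fun a => by simp [coeff_star]

instance [StarRing k] : StarRing (F.Alg k) where
  star_involutive x := F.alg_ext fun a => by simp [coeff_star, F.conj_conj]
  star_add := F.star_add'
  star_mul x y := by
    refine F.alg_induction (p := fun x => star (x * y) = star y * star x) x (by simp [star_zero'])
      (fun x x' h h' => by simp [add_mul, mul_add, star_add', h, h']) fun r a => ?_
    refine F.alg_induction (p := fun y => star (r • F.basis k a * y) =
      star y * star (r • F.basis k a)) y (by simp [star_zero'])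
      (fun x x' h h' => by rw [mul_add, star_add', star_add', add_mul, h, h']) fun s b => ?_
    simp only [smul_mul, mul_smul', star_smul', star_basis, basis_mul_basis]
    rw [smul_comm]
    congr 2
    refine F.alg_ext fun x => ?_
    rw [coeff_star, coeff_prod, coeff_prod, star_natCast, ← F.conj_mul, F.conj_conj]

instance [StarRing k] : StarModule k (F.Alg k) := ⟨F.star_smul'⟩

end Algebra

/-- A finite set `X` of irreducible objects generates `R` if it is symmetric and every irreducible
object is contained in some product `x₁ ⋯ xₙ` (`n ≥ 1`) of elements of `X`. -/
def Generates (X : Finset I) : Prop :=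
  (∀ x ∈ X, F.conj x ∈ X) ∧
    ∀ a : I, ∃ l : List I, l ≠ [] ∧ (∀ x ∈ l, x ∈ X) ∧ F.coeff a (l.map (F.basis ℤ)).prod ≠ 0

section Kazhdan

variable {H : Type*} [NormedAddCommGroup H] [InnerProductSpace ℂ H] [CompleteSpace H]

/-- The invariant vectors of a unital `*`-representation `π : C_R → B(H)`. -/
def Fix (π : F.Alg ℂ →⋆ₐ[ℂ] (H →L[ℂ] H)) : Set H :=
  {ξ | ∀ a : I, π (F.basis ℂ a) ξ = (F.d a : ℂ) • ξ}

/-- The Kazhdan constant of `π` with respect to the finite generating set `X`. The infimum and the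
maximum of these nonnegative reals are taken in the complete lattice `EReal`. -/
def KazOn (X : Finset I) (π : F.Alg ℂ →⋆ₐ[ℂ] (H →L[ℂ] H)) : EReal :=
  ⨅ ξ : {ξ : H // ‖ξ‖ = 1}, ⨆ a ∈ X,
    ((‖π (F.basis ℂ a) ξ.1 - (F.d a : ℂ) • ξ.1‖ / F.d a : ℝ) : EReal)

/-- The uniform Kazhdan constant of `π`. -/
def Kaz (π : F.Alg ℂ →⋆ₐ[ℂ] (H →L[ℂ] H)) : EReal :=
  ⨅ X : {X : Finset I // F.Generates X}, F.KazOn X.1 π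

end Kazhdan

section Regular

/-- The value at `η` of `ρ(α) ξ`, that is `∑ β, N_{β,ᾱ}^η ξ β`, the coefficient being written as
`N_{η,α}^β` by Frobenius reciprocity so that the sum is visibly finite. -/
def rhoFun (a : I) (ξ : I → ℂ) (η : I) : ℂ :=
  (F.fusion η a).sum fun β n => (n : ℂ) * ξ β

theorem sq_rhoFun_le (a : I) (ξ : I → ℂ) (η : I) :
    ‖F.rhoFun a ξ η‖ ^ 2 ≤
      F.d a * (F.fusion η a).sum fun β n => F.d η * n * (‖ξ β‖ ^ 2 / F.d β) := by
  have hpos : ∀ b, 0 < F.d b := fun b => lt_of_lt_of_le one_pos (F.one_le_d b)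
  have h1 : ‖F.rhoFun a ξ η‖ ≤ ∑ β ∈ (F.fusion η a).support, (F.fusion η a β : ℝ) * ‖ξ β‖ := by
    refine (norm_sum_le _ _).trans (le_of_eq ?_)
    simp
  have h2 := Finset.sum_mul_sq_le_sq_mul_sq (F.fusion η a).support
    (fun β => √((F.fusion η a β : ℝ) * F.d β))
    (fun β => √((F.fusion η a β : ℝ) * (‖ξ β‖ ^ 2 / F.d β)))
  have h3 : ∀ β, √((F.fusion η a β : ℝ) * F.d β) *
      √((F.fusion η a β : ℝ) * (‖ξ β‖ ^ 2 / F.d β)) = (F.fusion η a β : ℝ) * ‖ξ β‖ := by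
    intro β
    have := hpos β
    rw [← Real.sqrt_mul (by positivity)]
    rw [show (F.fusion η a β : ℝ) * F.d β * ((F.fusion η a β : ℝ) * (‖ξ β‖ ^ 2 / F.d β)) =
      ((F.fusion η a β : ℝ) * ‖ξ β‖) ^ 2 by field_simp]
    exact Real.sqrt_sq (by positivity)
  have h4 : ∀ β, √((F.fusion η a β : ℝ) * F.d β) ^ 2 = (F.fusion η a β : ℝ) * F.d β := by
    intro β
    have := hpos β
    exact Real.sq_sqrt (by positivity)
  have h5 : ∀ β, √((F.fusion η a β : ℝ) * (‖ξ β‖ ^ 2 / F.d β)) ^ 2 =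
      (F.fusion η a β : ℝ) * (‖ξ β‖ ^ 2 / F.d β) := by
    intro β
    have := hpos β
    exact Real.sq_sqrt (by positivity)
  simp only [h3, h4, h5] at h2
  have h6 : ∑ β ∈ (F.fusion η a).support, (F.fusion η a β : ℝ) * F.d β = F.d η * F.d a :=
    (F.d_mul η a).symm
  rw [h6] at h2
  calc _ ≤ (∑ β ∈ (F.fusion η a).support, (F.fusion η a β : ℝ) * ‖ξ β‖) ^ 2 := by gcongr
    _ ≤ _ := h2
    _ = _ := by
      rw [Finsupp.sum, Finset.mul_sum, Finset.mul_sum]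
      exact Finset.sum_congr rfl fun β _ => by ring

theorem sum_sq_rhoFun_le (a : I) (ξ : lp (fun _ : I => ℂ) 2) (s : Finset I) :
    ∑ η ∈ s, ‖F.rhoFun a ξ η‖ ^ 2 ≤ (F.d a * ‖ξ‖) ^ 2 := by
  classical
  have hpos : ∀ b, 0 < F.d b := fun b => lt_of_lt_of_le one_pos (F.one_le_d b)
  set T := s.biUnion fun η => (F.fusion η a).support with hT
  have h1 : ∀ η ∈ s, ‖F.rhoFun a ξ η‖ ^ 2 ≤
      ∑ β ∈ T, F.d a * (F.d η * F.fusion η a β * (‖ξ β‖ ^ 2 / F.d β)) := by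
    intro η hη
    refine (F.sq_rhoFun_le a ξ η).trans (le_of_eq ?_)
    rw [Finsupp.sum, Finset.mul_sum]
    refine Finset.sum_subset (Finset.subset_biUnion_of_mem (fun η => (F.fusion η a).support) hη)
      fun β _ hβ => ?_
    simp [Finsupp.notMem_support_iff.1 hβ]
  have h2 : ∀ β, ∑ η ∈ s, F.d η * F.fusion η a β ≤ F.d β * F.d a := by
    intro β
    rw [← F.d_conj a, F.d_mul, Finsupp.sum]
    have : ∀ η, F.d η * (F.fusion η a β : ℝ) = (F.fusion β (F.conj a) η : ℝ) * F.d η := by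
      intro η; rw [F.frobenius_right η a β, mul_comm]
    simp only [this]
    rw [← Finset.sum_filter_add_sum_filter_not s (fun η => η ∈ (F.fusion β (F.conj a)).support)]
    rw [Finset.sum_eq_zero (s := s.filter fun η => η ∉ (F.fusion β (F.conj a)).support), add_zero]
    · refine Finset.sum_le_sum_of_subset_of_nonneg (fun η hη => (Finset.mem_filter.1 hη).2) ?_
      intro η _ _
      have := hpos η
      positivity
    · intro η hη
      simp [Finsupp.notMem_support_iff.1 (Finset.mem_filter.1 hη).2]
  have h3 : ∑ β ∈ T, ‖ξ β‖ ^ 2 ≤ ‖ξ‖ ^ 2 := by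
    have := lp.sum_rpow_le_norm_rpow (p := 2) (by simp) ξ T
    simpa using this
  calc _ ≤ ∑ η ∈ s, ∑ β ∈ T, F.d a * (F.d η * F.fusion η a β * (‖ξ β‖ ^ 2 / F.d β)) :=
        Finset.sum_le_sum h1
    _ = ∑ β ∈ T, F.d a * ((∑ η ∈ s, F.d η * F.fusion η a β) * (‖ξ β‖ ^ 2 / F.d β)) := by
        rw [Finset.sum_comm]
        simp only [Finset.mul_sum, Finset.sum_mul]
    _ ≤ ∑ β ∈ T, F.d a * ((F.d β * F.d a) * (‖ξ β‖ ^ 2 / F.d β)) := by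
        refine Finset.sum_le_sum fun β _ => ?_
        have := hpos β
        have := hpos a
        have := h2 β
        gcongr
    _ = F.d a ^ 2 * ∑ β ∈ T, ‖ξ β‖ ^ 2 := by
        rw [Finset.mul_sum]
        refine Finset.sum_congr rfl fun β _ => ?_
        have := hpos β
        field_simp
    _ ≤ _ := by rw [mul_pow]; gcongr

/-- The bounded operator `ρ(α)` on `ℓ²(I)`. -/
def rhoOp (a : I) : lp (fun _ : I => ℂ) 2 →L[ℂ] lp (fun _ : I => ℂ) 2 :=
  LinearMap.mkContinuous
    { toFun := fun ξ => ⟨F.rhoFun a ξ, by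
        refine memℓp_gen' (C := (F.d a * ‖ξ‖) ^ 2) fun s => ?_
        simpa using F.sum_sq_rhoFun_le a ξ s⟩
      map_add' := fun ξ ζ => by
        ext η
        change F.rhoFun a _ η = F.rhoFun a _ η + F.rhoFun a _ η
        simp [rhoFun, Finsupp.sum, mul_add, Finset.sum_add_distrib]
      map_smul' := fun r ξ => by
        ext η
        simp [rhoFun, Finsupp.sum, Finset.mul_sum, mul_left_comm] }
    (F.d a) fun ξ => by
      refine lp.norm_le_of_forall_sum_le (p := 2) (by simp) ?_ fun s => ?_
      · have := F.one_le_d a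
        positivity
      · simpa using F.sum_sq_rhoFun_le a ξ s

theorem rhoOp_apply (a : I) (ξ : lp (fun _ : I => ℂ) 2) (η : I) :
    F.rhoOp a ξ η = (F.fusion η a).sum fun β n => (n : ℂ) * ξ β := rfl

/-- `ρ(α) δ_β = ∑ η, N_{β,ᾱ}^η δ_η`. -/
theorem rhoOp_single [DecidableEq I] (a b : I) :
    F.rhoOp a (lp.single 2 b 1) =
      (F.fusion b (F.conj a)).sum fun η n => (n : ℂ) • lp.single 2 η (1 : ℂ) := by
  ext x
  rw [rhoOp_apply, Finsupp.sum, Finsupp.sum, lp.coeFn_sum, Finset.sum_apply]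
  simp only [lp.coeFn_smul, Pi.smul_apply, lp.single_apply, Pi.single_apply, smul_eq_mul,
    mul_ite, mul_one, mul_zero]
  rw [Finset.sum_ite_eq', Finset.sum_ite_eq, F.frobenius_right x a b]
  simp only [Finsupp.mem_support_iff, F.frobenius_right x a b]

theorem rhoOp_e : F.rhoOp F.e = 1 := by
  ext ξ η
  simp [rhoOp_apply, F.mul_e]

theorem rhoOp_mul (a b : I) :
    F.rhoOp a * F.rhoOp b = (F.fusion a b).sum fun x n => (n : ℂ) • F.rhoOp x := by
  classical
  ext ξ η
  have hl : (F.rhoOp a * F.rhoOp b) ξ η = (F.fusion η a).sum fun x n =>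
      (n : ℂ) * (F.fusion x b).sum fun y m => (m : ℂ) * ξ y := rfl
  have hr : ((F.fusion a b).sum fun x n => (n : ℂ) • F.rhoOp x) ξ η = (F.fusion a b).sum fun x n =>
      (n : ℂ) * (F.fusion η x).sum fun y m => (m : ℂ) * ξ y := by
    rw [Finsupp.sum, sum_apply, lp.coeFn_sum, Finset.sum_apply]
    rfl
  rw [hl, hr]
  set T : Finset I := ((F.fusion η a).support.biUnion fun x => (F.fusion x b).support) ∪
    (F.fusion a b).support.biUnion fun x => (F.fusion η x).support with hT
  have h1 : ∀ x ∈ (F.fusion η a).support, ((F.fusion x b).sum fun y m => (m : ℂ) * ξ y) =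
      ∑ y ∈ T, (F.fusion x b y : ℂ) * ξ y := fun x hx => by
    refine Finset.sum_subset ((Finset.subset_biUnion_of_mem
      (fun x => (F.fusion x b).support) hx).trans Finset.subset_union_left) fun y _ hy => ?_
    simp [Finsupp.notMem_support_iff.1 hy]
  have h2 : ∀ x ∈ (F.fusion a b).support, ((F.fusion η x).sum fun y m => (m : ℂ) * ξ y) =
      ∑ y ∈ T, (F.fusion η x y : ℂ) * ξ y := fun x hx => by
    refine Finset.sum_subset ((Finset.subset_biUnion_of_mem
      (fun x => (F.fusion η x).support) hx).trans Finset.subset_union_right) fun y _ hy => ?_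
    simp [Finsupp.notMem_support_iff.1 hy]
  have hl' : ((F.fusion η a).sum fun x n =>
      (n : ℂ) * (F.fusion x b).sum fun y m => (m : ℂ) * ξ y) =
      ∑ x ∈ (F.fusion η a).support, (F.fusion η a x : ℂ) * ∑ y ∈ T, (F.fusion x b y : ℂ) * ξ y :=
    Finset.sum_congr rfl fun x hx => congrArg _ (h1 x hx)
  have hr' : ((F.fusion a b).sum fun x n =>
      (n : ℂ) * (F.fusion η x).sum fun y m => (m : ℂ) * ξ y) =
      ∑ x ∈ (F.fusion a b).support, (F.fusion a b x : ℂ) * ∑ y ∈ T, (F.fusion η x y : ℂ) * ξ y :=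
    Finset.sum_congr rfl fun x hx => congrArg _ (h2 x hx)
  rw [hl', hr']
  simp only [Finset.mul_sum]
  rw [Finset.sum_comm, Finset.sum_comm (s := (F.fusion a b).support)]
  refine Finset.sum_congr rfl fun y _ => ?_
  have h := congrArg (Nat.cast : ℕ → ℂ) (F.assoc η a b y)
  simp only [Finsupp.sum, Nat.cast_sum, Nat.cast_mul] at h
  simp only [← mul_assoc, ← Finset.sum_mul, h]

theorem rhoOp_star (a : I) : star (F.rhoOp a) = F.rhoOp (F.conj a) := by
  classical
  rw [ContinuousLinearMap.star_eq_adjoint]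
  ext x η
  have h : ⟪(lp.single 2 η 1 : lp (fun _ : I => ℂ) 2),
      ContinuousLinearMap.adjoint (F.rhoOp a) x⟫_ℂ =
      ContinuousLinearMap.adjoint (F.rhoOp a) x η := by
    rw [lp.inner_single_left]; simp
  rw [← h, ContinuousLinearMap.adjoint_inner_right, rhoOp_single, rhoOp_apply, Finsupp.sum,
    Finsupp.sum, sum_inner]
  refine Finset.sum_congr rfl fun y _ => ?_
  rw [inner_smul_left, lp.inner_single_left]
  simp

/-- The right regular representation `ρ : C_R → B(ℓ²(I))`, a unital `*`-representation:
the linear extension of `α ↦ ρ(α)`. -/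
def rho : F.Alg ℂ →⋆ₐ[ℂ] (lp (fun _ : I => ℂ) 2 →L[ℂ] lp (fun _ : I => ℂ) 2) :=
  { AlgHom.ofLinearMap (F.lift F.rhoOp)
      (by rw [one_def, lift_basis, rhoOp_e])
      (fun x y => by
        refine F.alg_induction (p := fun x => F.lift F.rhoOp (x * y) =
          F.lift F.rhoOp x * F.lift F.rhoOp y) x (by simp)
          (fun x x' h h' => by simp only [add_mul, map_add, h, h']) fun r a => ?_
        refine F.alg_induction (p := fun y => F.lift F.rhoOp (r • F.basis ℂ a * y) =
          F.lift F.rhoOp (r • F.basis ℂ a) * F.lift F.rhoOp y) y (by simp)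
          (fun x x' h h' => by simp only [mul_add, map_add, h, h']) fun s b => ?_
        rw [smul_mul, mul_smul', basis_mul_basis, prod_eq_sum]
        simp only [map_smul, Finsupp.sum, map_sum, lift_basis, smul_mul_assoc, mul_smul_comm]
        rw [rhoOp_mul, Finsupp.sum, smul_comm]) with
    map_star' := fun x => by
      change F.lift F.rhoOp (star x) = star (F.lift F.rhoOp x)
      refine F.alg_induction (p := fun x => F.lift F.rhoOp (star x) = star (F.lift F.rhoOp x)) x
        (by simp) (fun x x' h h' => by simp only [star_add, map_add, h, h']) fun r a => ?_
      rw [star_smul, star_basis, map_smul, map_smul, lift_basis, lift_basis, star_smul,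
        rhoOp_star] }

theorem rho_basis (a : I) : F.rho (F.basis ℂ a) = F.rhoOp a :=
  F.lift_basis F.rhoOp a

/-- `ρ(α) δ_β = ∑ η, N_{β,ᾱ}^η δ_η`. -/
theorem rho_basis_single [DecidableEq I] (a b : I) :
    F.rho (F.basis ℂ a) (lp.single 2 b 1) =
      (F.fusion b (F.conj a)).sum fun η n => (n : ℂ) • lp.single 2 η (1 : ℂ) := by
  rw [rho_basis, rhoOp_single]

end Regular

end FusionAlgebra

/-- The `q`-number `[n]_q`. -/
def qNumber (q : ℝ) (n : ℕ) : ℝ :=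
  if q = 1 then n else (q⁻¹ ^ n - q ^ n) / (q⁻¹ - q)

/-- `N_{m,n}^k` for `SO_q(3)`. -/
def so3Fusion (m n : ℕ) : ℕ →₀ ℕ :=
  ∑ k ∈ Finset.Icc (max m n - min m n) (m + n), Finsupp.single k 1

theorem so3Fusion_apply (m n k : ℕ) :
    so3Fusion m n k = if m ≤ n + k ∧ n ≤ m + k ∧ k ≤ m + n then 1 else 0 := by
  rw [so3Fusion, Finsupp.finsetSum_apply]
  simp only [Finsupp.single_apply, Finset.sum_ite_eq', Finset.mem_Icc]
  congr 1
  apply propext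
  omega

theorem so3Fusion_support (m n : ℕ) :
    (so3Fusion m n).support = Finset.Icc (max m n - min m n) (m + n) := by
  ext k
  rw [Finsupp.mem_support_iff, so3Fusion_apply, Finset.mem_Icc]
  split_ifs with h
  · simp; omega
  · simp; omega

theorem so3Fusion_assoc (a b c x : ℕ) :
    ((so3Fusion a b).sum fun y n => n * so3Fusion y c x) =
      (so3Fusion b c).sum fun y n => n * so3Fusion a y x := by
  have key : ∀ (s : Finset ℕ) (u v : ℕ) (f : ℕ → ℕ) (g : ℕ → ℕ), (∀ y ∈ s, f y = 1) →
      (∀ y, g y = if u ≤ y ∧ y ≤ v then 1 else 0) →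
      ∑ y ∈ s, f y * g y = (s ∩ Finset.Icc u v).card := by
    intro s u v f g hf hg
    rw [Finset.card_eq_sum_ones, ← Finset.filter_mem_eq_inter, Finset.sum_filter]
    refine Finset.sum_congr rfl fun y hy => ?_
    rw [hf y hy, hg y, one_mul]
    simp only [Finset.mem_Icc]
  have hinter : ∀ u v u' v' : ℕ, Finset.Icc u v ∩ Finset.Icc u' v' =
      Finset.Icc (max u u') (min v v') := by
    intro u v u' v'
    ext y
    simp only [Finset.mem_inter, Finset.mem_Icc]
    omega
  rw [Finsupp.sum, Finsupp.sum,
    key (so3Fusion a b).support (max c x - min c x) (c + x) _ _ ?_ ?_,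
    key (so3Fusion b c).support (max a x - min a x) (a + x) _ _ ?_ ?_,
    so3Fusion_support, so3Fusion_support, hinter, hinter, Nat.card_Icc, Nat.card_Icc]
  · rcases le_total a b with h1 | h1 <;> rcases le_total c x with h2 | h2 <;>
      rcases le_total b c with h3 | h3 <;> rcases le_total a x with h4 | h4 <;>
      simp only [max_eq_left, max_eq_right, min_eq_left, min_eq_right, h1, h2, h3, h4] <;> omega
  all_goals
    intro y
    simp only [so3Fusion_support, so3Fusion_apply, Finset.mem_Icc]
    first
      | (intro hy; rw [if_pos (by omega)])
      | (congr 1; apply propext; omega)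

theorem inv_sub_ne {q : ℝ} (hq : 0 < q) (h : ¬q = 1) : q⁻¹ - q ≠ 0 := by
  intro h'
  have h2 : q⁻¹ * q = 1 := inv_mul_cancel₀ hq.ne'
  apply h
  nlinarith

theorem qNumber_one (q : ℝ) (hq : 0 < q) : qNumber q 1 = 1 := by
  unfold qNumber
  split_ifs with h
  · simp
  · have : q⁻¹ - q ≠ 0 := inv_sub_ne hq h
    have h2 : q⁻¹ * q = 1 := inv_mul_cancel₀ hq.ne'
    generalize q⁻¹ = p at *
    simp [div_self this]

theorem qNumber_add_two (q : ℝ) (hq : 0 < q) (n : ℕ) :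
    qNumber q (n + 2) = qNumber q n + (q ^ (n + 1) + q⁻¹ ^ (n + 1)) := by
  unfold qNumber
  split_ifs with h
  · simp [h]; ring
  · have : q⁻¹ - q ≠ 0 := inv_sub_ne hq h
    have h2 : q⁻¹ * q = 1 := inv_mul_cancel₀ hq.ne'
    generalize q⁻¹ = p at *
    rw [div_add' _ _ _ this]
    congr 1
    linear_combination (q ^ n - p ^ n) * -h2

theorem qNumber_mul_pow (q : ℝ) (hq : 0 < q) (j n : ℕ) :
    qNumber q (2 * (n + 1 + j) + 1) * (q ^ (2 * n + 2) + q⁻¹ ^ (2 * n + 2)) =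
      qNumber q (2 * (n + 1 + j + (n + 1)) + 1) + qNumber q (2 * j + 1) := by
  unfold qNumber
  split_ifs with h
  · simp [h]; ring
  · have : q⁻¹ - q ≠ 0 := inv_sub_ne hq h
    have h2 : q⁻¹ * q = 1 := inv_mul_cancel₀ hq.ne'
    generalize q⁻¹ = p at *
    rw [← add_div, div_mul_eq_mul_div]
    congr 1
    have h3 : p ^ (2 * n + 2) * q ^ (2 * n + 2) = 1 := by rw [← mul_pow, h2, one_pow]
    linear_combination (p ^ (2 * j + 1) - q ^ (2 * j + 1)) * h3

theorem one_le_qNumber (q : ℝ) (hq : 0 < q) (n : ℕ) : 1 ≤ qNumber q (2 * n + 1) := by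
  induction n with
  | zero => simp [qNumber_one q hq]
  | succ n ih =>
    have h := qNumber_add_two q hq (2 * n + 1)
    rw [show 2 * (n + 1) + 1 = 2 * n + 1 + 2 by ring, h]
    have : 0 < q ^ (2 * n + 1 + 1) + q⁻¹ ^ (2 * n + 1 + 1) := by positivity
    linarith

theorem qNumber_mul (q : ℝ) (hq : 0 < q) (j n : ℕ) :
    qNumber q (2 * (n + j) + 1) * qNumber q (2 * n + 1) =
      ∑ k ∈ Finset.Icc j (2 * n + j), qNumber q (2 * k + 1) := by
  induction n generalizing j with
  | zero => simp [qNumber_one q hq]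
  | succ n ih =>
    have h := ih (j + 1)
    rw [show 2 * (n + 1) + 1 = 2 * n + 1 + 2 by ring, qNumber_add_two q hq (2 * n + 1), mul_add,
      show n + 1 + j = n + (j + 1) by ring, h, show 2 * n + 1 + 1 = 2 * n + 2 by ring,
      show n + (j + 1) = n + 1 + j by ring, add_comm (q ^ _), add_comm (q⁻¹ ^ _),
      qNumber_mul_pow q hq j n]
    rw [show 2 * (n + 1) + j = 2 * n + (j + 1) + 1 by ring,
      Finset.sum_Icc_succ_top (by omega),
      ← Finset.add_sum_Ioc_eq_sum_Icc (show j ≤ 2 * n + (j + 1) by omega)]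
    have : Finset.Ioc j (2 * n + (j + 1)) = Finset.Icc (j + 1) (2 * n + (j + 1)) := by
      ext; simp only [Finset.mem_Ioc, Finset.mem_Icc]; omega
    rw [this, show n + 1 + j + (n + 1) = 2 * n + (j + 1) + 1 by ring]
    ring

/-- The fusion algebra `R(SO_q(3))` with the quantum dimension function: the irreducible
representations are indexed by `ℕ`, all are self-conjugate,
`m ⊗ n = |m - n| ⊕ (|m - n| + 1) ⊕ ⋯ ⊕ (m + n)`, and `d(n) = [2n+1]_q`. -/
def fusionSO3 (q : ℝ) (hq : 0 < q) : FusionAlgebra ℕ where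
  e := 0
  conj := id
  fusion := so3Fusion
  d n := qNumber q (2 * n + 1)
  e_mul a := by simp [so3Fusion]
  mul_e a := by simp [so3Fusion]
  assoc := so3Fusion_assoc
  conj_conj _ := rfl
  conj_mul a b x := by simp only [id, so3Fusion_apply]; congr 1; apply propext; omega
  frobenius_right a b x := by simp only [id, so3Fusion_apply]; congr 1; apply propext; omega
  frobenius_left a b x := by simp only [id, so3Fusion_apply]; congr 1; apply propext; omega
  d_conj _ := rfl
  one_le_d := one_le_qNumber q hq
  d_mul a b := by
    have h : ((so3Fusion a b).sum fun x n => (n : ℝ) * qNumber q (2 * x + 1)) =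
        ∑ k ∈ Finset.Icc (max a b - min a b) (a + b), qNumber q (2 * k + 1) := by
      rw [Finsupp.sum, so3Fusion_support]
      refine Finset.sum_congr rfl fun k hk => ?_
      rw [Finset.mem_Icc] at hk
      rw [so3Fusion_apply, if_pos (by omega)]
      simp
    rw [h]
    rcases le_total b a with hab | hab
    · obtain ⟨j, rfl⟩ := Nat.exists_eq_add_of_le hab
      rw [qNumber_mul q hq]
      congr 1
      congr 1 <;> omega
    · obtain ⟨j, rfl⟩ := Nat.exists_eq_add_of_le hab
      rw [mul_comm, qNumber_mul q hq]
      congr 1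
      congr 1 <;> omega

end

/-! The operators `ρ(a)` depend only on the fusion rules, hence not on `q`; only the number `d(a) =
[2a+1]_q` they are compared with does. The Schur-type estimate `sum_sq_rhoFun_le`, applied with the
dimension function at `q = 1`, therefore gives `‖ρ(a)‖ ≤ 2a+1` for every `q`
(`norm_rhoOp_fusionSO3_le`).

Lower bound: a generating set contains some `a ≥ 1`, and for a unit vector the displacement at `a`
is at least `1 - (2a+1)/[2a+1]_q`. This is smallest at `a = 1`, because `[2a+1]_q/(2a+1)` is minimal
there (`mul_qNumber_three_le`).

Upper bound: `{1}` is generating, and `ρ(1)` is a tridiagonal matrix of ones except for a zero in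
the top left corner. Normalized indicators of long initial segments are almost eigenvectors for the
eigenvalue `3` (`norm_rhoOp_one_lpIndicator_sub_le`), so their displacement tends to `([3]_q -
3)/[3]_q`.

There are no invariant vectors because row `0` of `ρ(a)` reads off `ξ a`: an invariant `ξ` is a
multiple of `d`, which is bounded below by `1` and so not square summable. -/

/-! ### Inequalities for q-numbers -/

theorem two_le_pow_add_inv_pow {q : ℝ} (hq : 0 < q) (m : ℕ) : 2 ≤ q ^ m + q⁻¹ ^ m := by
  have h : q⁻¹ ^ m * q ^ m = 1 := by rw [← mul_pow, inv_mul_cancel₀ hq.ne', one_pow]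
  have h1 : 0 < q ^ m := by positivity
  have h2 : 0 < q⁻¹ ^ m := by positivity
  nlinarith [sq_nonneg (q ^ m - q⁻¹ ^ m)]

/-- With `p = q⁻¹`, the increment factors as `(p - 1)(p ^ m - q ^ (m+1))`, and both factors are
nonnegative because `q ≤ 1 ≤ p`. -/
theorem pow_add_inv_pow_le_succ {q : ℝ} (hq : 0 < q) (hq1 : q ≤ 1) (m : ℕ) :
    q ^ m + q⁻¹ ^ m ≤ q ^ (m + 1) + q⁻¹ ^ (m + 1) := by
  have hp : 1 ≤ q⁻¹ := (one_le_inv₀ hq).2 hq1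
  have h : q⁻¹ * q = 1 := inv_mul_cancel₀ hq.ne'
  have h1 : q ^ (m + 1) ≤ 1 := pow_le_one₀ hq.le hq1
  have h2 : 1 ≤ q⁻¹ ^ m := one_le_pow₀ hp
  have h3 : q ^ (m + 1) + q⁻¹ ^ (m + 1) - (q ^ m + q⁻¹ ^ m) =
      (q⁻¹ - 1) * (q⁻¹ ^ m - q ^ (m + 1)) := by
    linear_combination q ^ m * h
  have h4 : 0 ≤ (q⁻¹ - 1) * (q⁻¹ ^ m - q ^ (m + 1)) :=
    mul_nonneg (by linarith) (by linarith)
  linarith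

theorem monotone_pow_add_inv_pow {q : ℝ} (hq : 0 < q) (hq1 : q ≤ 1) :
    Monotone fun m : ℕ => q ^ m + q⁻¹ ^ m :=
  monotone_nat_of_le_succ (pow_add_inv_pow_le_succ hq hq1)

theorem qNumber_three {q : ℝ} (hq : 0 < q) : qNumber q 3 = 1 + (q ^ 2 + q⁻¹ ^ 2) := by
  simpa [qNumber_one q hq] using qNumber_add_two q hq 1

theorem three_le_qNumber_three {q : ℝ} (hq : 0 < q) : 3 ≤ qNumber q 3 := by
  rw [qNumber_three hq]
  linarith [two_le_pow_add_inv_pow hq 2]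

/-- The ratio `[2n+1]_q / (2n+1)` is minimal, over `n ≥ 1`, at `n = 1`. -/
theorem mul_qNumber_three_le {q : ℝ} (hq : 0 < q) (hq1 : q ≤ 1) (n : ℕ) :
    (2 * ((n + 1 : ℕ) : ℝ) + 1) * qNumber q 3 ≤ 3 * qNumber q (2 * (n + 1) + 1) := by
  induction n with
  | zero => norm_num
  | succ n ih =>
    -- With `c = q² + q⁻²`, the left side grows by `2[3]_q = 2 + 2c` and the right side by at least
    -- `3c`, by monotonicity of the exponent sums; `c ≥ 2` closes the gap.
    rw [show 2 * (n + 1 + 1) + 1 = 2 * (n + 1) + 1 + 2 by ring,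
      qNumber_add_two q hq (2 * (n + 1) + 1)]
    have h1 : q ^ 2 + q⁻¹ ^ 2 ≤ q ^ (2 * (n + 1) + 1 + 1) + q⁻¹ ^ (2 * (n + 1) + 1 + 1) :=
      monotone_pow_add_inv_pow hq hq1 (by omega : 2 ≤ 2 * (n + 1) + 1 + 1)
    have h2 := two_le_pow_add_inv_pow hq 2
    have h3 := qNumber_three hq
    push_cast at ih ⊢
    linarith

/-! ### The regular representation: norm bound, invariant vectors, almost eigenvectors -/

section RegularRepresentation

variable {q : ℝ} (hq : 0 < q)

/-- `‖ρ(a)‖ ≤ 2a+1`, independently of `q`. -/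
theorem norm_rhoOp_fusionSO3_le (a : ℕ) (ξ : lp (fun _ : ℕ => ℂ) 2) :
    ‖(fusionSO3 q hq).rhoOp a ξ‖ ≤ (2 * (a : ℝ) + 1) * ‖ξ‖ := by
  -- The bound is read off from the fusion algebra at `q = 1`, where `d(a) = 2a+1`; `h2` below is
  -- `rfl` since the formula for `ρ(a)` never mentions `q`.
  have h1 : (fusionSO3 1 one_pos).d a = 2 * (a : ℝ) + 1 := by
    simp [fusionSO3, qNumber]
  rw [← h1]
  refine lp.norm_le_of_forall_sum_le (p := 2) (by simp) ?_ fun s => ?_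
  · have := (fusionSO3 1 one_pos).one_le_d a
    positivity
  · have h := (fusionSO3 1 one_pos).sum_sq_rhoFun_le a ξ s
    have h2 : (fusionSO3 1 one_pos).rhoFun a ξ = (fusionSO3 q hq).rhoOp a ξ := rfl
    rw [h2] at h
    simpa using h

theorem rhoOp_fusionSO3_apply_zero (a : ℕ) (ξ : lp (fun _ : ℕ => ℂ) 2) :
    (fusionSO3 q hq).rhoOp a ξ 0 = ξ a := by
  have h : (fusionSO3 q hq).fusion 0 a = Finsupp.single a 1 := (fusionSO3 q hq).e_mul a
  rw [FusionAlgebra.rhoOp_apply, h]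
  simp

theorem rhoOp_fusionSO3_one_apply_succ (n : ℕ) (ξ : lp (fun _ : ℕ => ℂ) 2) :
    (fusionSO3 q hq).rhoOp 1 ξ (n + 1) = ξ n + ξ (n + 1) + ξ (n + 2) := by
  have h : (fusionSO3 q hq).fusion (n + 1) 1 =
      Finsupp.single n 1 + Finsupp.single (n + 1) 1 + Finsupp.single (n + 2) 1 := by
    change so3Fusion (n + 1) 1 = _
    have : Finset.Icc (max (n + 1) 1 - min (n + 1) 1) (n + 1 + 1) = {n, n + 1, n + 2} := by
      ext k
      simp only [Finset.mem_Icc, Finset.mem_insert, Finset.mem_singleton]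
      omega
    rw [so3Fusion, this, Finset.sum_insert (by simp), Finset.sum_insert (by simp),
      Finset.sum_singleton, add_assoc]
  rw [FusionAlgebra.rhoOp_apply, h, Finsupp.sum_add_index' (by simp) (by simp [add_mul]),
    Finsupp.sum_add_index' (by simp) (by simp [add_mul])]
  simp

/-- Evaluating the invariance equation at coordinate `0` gives `ξ a = d(a) ξ 0`, so `‖ξ a‖ ≥ ‖ξ 0‖`
for all `a`; square summability then forces `ξ 0 = 0`. -/
theorem fix_rho_fusionSO3 : (fusionSO3 q hq).Fix (fusionSO3 q hq).rho = {0} := by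
  refine Set.Subset.antisymm (fun ξ hξ => ?_) (by rintro _ rfl a; simp)
  have h : ∀ a, ξ a = ((fusionSO3 q hq).d a : ℂ) * ξ 0 := fun a => by
    have h1 := hξ a
    rw [FusionAlgebra.rho_basis] at h1
    rw [← rhoOp_fusionSO3_apply_zero hq a ξ, h1, lp.coeFn_smul]
    rfl
  have hle : ∀ a, ‖ξ 0‖ ^ 2 ≤ ‖ξ a‖ ^ 2 := fun a => by
    have h1 := (fusionSO3 q hq).one_le_d a
    rw [h a, norm_mul, Complex.norm_real, Real.norm_of_nonneg (by linarith)]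
    gcongr
    exact le_mul_of_one_le_left (norm_nonneg _) h1
  have hs : Summable fun a => ‖ξ a‖ ^ 2 := by
    simpa using (lp.memℓp ξ).summable (by simp)
  have h0 : ‖ξ 0‖ ^ 2 ≤ 0 := ge_of_tendsto' hs.tendsto_atTop_zero hle
  have h0' : ξ 0 = 0 := by
    rw [← norm_eq_zero]
    exact pow_eq_zero_iff two_ne_zero |>.1 (le_antisymm h0 (by positivity))
  rw [Set.mem_singleton_iff]
  ext a
  rw [h a, h0', mul_zero]
  rfl

/-- The indicator function of `{0, …, N-1}` in `ℓ²(ℕ)`. -/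
noncomputable def lpIndicator (N : ℕ) : lp (fun _ : ℕ => ℂ) 2 := ∑ n ∈ Finset.range N, lp.single 2 n 1

theorem lpIndicator_apply (N k : ℕ) : lpIndicator N k = if k < N then 1 else 0 := by
  rw [lpIndicator, lp.coeFn_sum, Finset.sum_apply]
  simp [lp.single_apply, Pi.single_apply]

theorem norm_lpIndicator (N : ℕ) : ‖lpIndicator N‖ = √N := by
  have h := lp.norm_sum_single (E := fun _ : ℕ => ℂ) (p := 2) (by simp) (fun _ => 1)
    (Finset.range N)
  have h2 : ‖lpIndicator N‖ ^ 2 = N := by simpa [lpIndicator] using h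
  rw [← h2, Real.sqrt_sq (norm_nonneg _)]

/-- Every row of `ρ(1)` other than row `0` sums to `3`, so the defect lives at the ends of the
segment: `-2` at `0`, `-1` at `N+1`, `1` at `N+2`. The bound `4 = 2 + 1 + 1` is independent of `N`,
whereas the indicator has norm `√(N+2)`. Length at least `2` ensures that row `0` sees a `1` at
coordinate `1`. -/
theorem norm_rhoOp_one_lpIndicator_sub_le (N : ℕ) :
    ‖(fusionSO3 q hq).rhoOp 1 (lpIndicator (N + 2)) - (3 : ℂ) • lpIndicator (N + 2)‖ ≤ 4 := by
  have h : (fusionSO3 q hq).rhoOp 1 (lpIndicator (N + 2)) - (3 : ℂ) • lpIndicator (N + 2) =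
      lp.single 2 0 (-2 : ℂ) + lp.single 2 (N + 1) (-1 : ℂ) + lp.single 2 (N + 2) (1 : ℂ) := by
    ext k
    simp only [lp.coeFn_sub, lp.coeFn_add, lp.coeFn_smul, Pi.sub_apply, Pi.add_apply,
      Pi.smul_apply, smul_eq_mul, lp.single_apply, Pi.single_apply]
    rcases k with _ | k
    · rw [rhoOp_fusionSO3_apply_zero]
      simp [lpIndicator_apply]
      norm_num
    · rw [rhoOp_fusionSO3_one_apply_succ]
      simp only [lpIndicator_apply]
      rcases lt_trichotomy k N with hk | rfl | hk
      · rw [if_pos (by omega), if_pos (by omega), if_pos (by omega), if_neg (by omega),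
          if_neg (by omega), if_neg (by omega)]
        norm_num
      · rw [if_pos (by omega), if_pos (by omega), if_neg (by omega), if_neg (by omega),
          if_pos (by omega), if_neg (by omega)]
        norm_num
      · by_cases hk' : k = N + 1
        · rw [if_pos (by omega), if_neg (by omega), if_neg (by omega), if_neg (by omega),
            if_neg (by omega), if_pos (by omega)]
          norm_num
        · rw [if_neg (by omega), if_neg (by omega), if_neg (by omega), if_neg (by omega),
            if_neg (by omega), if_neg (by omega)]
          norm_num
  rw [h]
  refine (norm_add₃_le).trans ?_
  rw [lp.norm_single (by simp), lp.norm_single (by simp), lp.norm_single (by simp)]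
  norm_num

/-! ### Generating sets -/

theorem coeff_mul_basis_one (k : ℕ) (x : (fusionSO3 q hq).Alg ℤ) :
    (fusionSO3 q hq).coeff (k + 1) (x * (fusionSO3 q hq).basis ℤ 1) =
      (fusionSO3 q hq).coeff k x + (fusionSO3 q hq).coeff (k + 1) x +
        (fusionSO3 q hq).coeff (k + 2) x := by
  refine (fusionSO3 q hq).alg_induction (p := fun x =>
    (fusionSO3 q hq).coeff (k + 1) (x * (fusionSO3 q hq).basis ℤ 1) =
      (fusionSO3 q hq).coeff k x + (fusionSO3 q hq).coeff (k + 1) x +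
        (fusionSO3 q hq).coeff (k + 2) x) x (by simp) (fun x y hx hy => ?_) fun r a => ?_
  · simp only [add_mul, map_add, hx, hy]
    ring
  · rw [FusionAlgebra.smul_mul, FusionAlgebra.basis_mul_basis]
    simp only [map_smul, FusionAlgebra.coeff_basis, FusionAlgebra.coeff_prod, smul_eq_mul]
    rw [← mul_add, ← mul_add]
    congr 1
    change ((so3Fusion a 1 (k + 1) : ℕ) : ℤ) = _
    rw [so3Fusion_apply]
    split_ifs <;> omega

/-- Unitriangularity: tensoring with `1` raises the top constituent by exactly one, with
multiplicity one. Hence `n` occurs in the `n`-th power of `1`. -/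
theorem coeff_basis_one_pow (n : ℕ) :
    (∀ k, n < k → (fusionSO3 q hq).coeff k ((fusionSO3 q hq).basis ℤ 1 ^ n) = 0) ∧
      (fusionSO3 q hq).coeff n ((fusionSO3 q hq).basis ℤ 1 ^ n) = 1 := by
  induction n with
  | zero =>
    rw [pow_zero, FusionAlgebra.one_def]
    refine ⟨fun k hk => ?_, ?_⟩
    · rw [FusionAlgebra.coeff_basis]
      exact if_neg hk.ne
    · rw [FusionAlgebra.coeff_basis]
      exact if_pos rfl
  | succ n ih =>
    refine ⟨fun k hk => ?_, ?_⟩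
    · obtain ⟨k, rfl⟩ := Nat.exists_eq_add_of_le' (show 1 ≤ k by omega)
      rw [pow_succ, coeff_mul_basis_one, ih.1 _ (by omega), ih.1 _ (by omega), ih.1 _ (by omega)]
      rfl
    · rw [pow_succ, coeff_mul_basis_one, ih.2, ih.1 _ (by omega), ih.1 _ (by omega)]
      rfl

theorem generates_singleton_one : (fusionSO3 q hq).Generates {1} := by
  refine ⟨fun x hx => hx, fun a => ?_⟩
  rcases a with _ | a
  -- The zeroth power is the empty product, which is not allowed; the unit is found in `1 ⊗ 1`
  -- instead.
  · refine ⟨[1, 1], by simp, by simp, ?_⟩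
    simp only [List.map_cons, List.map_nil, List.prod_cons, List.prod_nil, mul_one]
    rw [FusionAlgebra.basis_mul_basis, FusionAlgebra.coeff_prod]
    change ((so3Fusion 1 1 0 : ℕ) : ℤ) ≠ 0
    simp [so3Fusion_apply]
  · refine ⟨List.replicate (a + 1) 1, by simp, fun x hx => ?_, ?_⟩
    · exact Finset.mem_singleton.2 (List.eq_of_mem_replicate hx)
    · rw [List.map_replicate, List.prod_replicate, (coeff_basis_one_pow hq (a + 1)).2]
      exact one_ne_zero

/-- A generating set contains an irreducible object other than the unit. -/
theorem FusionAlgebra.Generates.exists_ne {X : Finset ℕ} (hX : (fusionSO3 q hq).Generates X) :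
    ∃ a, a + 1 ∈ X := by
  by_contra! h
  -- If `X ⊆ {0}`, every product of elements of `X` is the unit, in which the object `1` does not
  -- occur.
  obtain ⟨l, -, hl, hc⟩ := hX.2 1
  refine hc ?_
  have h1 : (l.map ((fusionSO3 q hq).basis ℤ)).prod = 1 := by
    refine List.prod_eq_one fun x hx => ?_
    obtain ⟨a, ha, rfl⟩ := List.mem_map.1 hx
    rcases a with _ | a
    · rfl
    · exact absurd (hl _ ha) (h a)
  rw [h1, FusionAlgebra.one_def, FusionAlgebra.coeff_basis]
  exact if_neg (by simp [fusionSO3])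

/-! ### The two bounds for the Kazhdan constant -/

theorem le_kaz_rho_fusionSO3 (hq1 : q ≤ 1) :
    ((1 - 3 / qNumber q 3 : ℝ) : EReal) ≤ (fusionSO3 q hq).Kaz (fusionSO3 q hq).rho := by
  refine le_iInf fun X => le_iInf fun ξ => ?_
  obtain ⟨n, hn⟩ := X.2.exists_ne
  -- The maximum over `X` is bounded below by its term at one nontrivial object; the reverse
  -- triangle inequality then gives `d - (2(n+1)+1)` for the numerator.
  refine le_trans ?_ (le_iSup₂ (n + 1) hn)
  rw [EReal.coe_le_coe_iff, FusionAlgebra.rho_basis]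
  have h3 := three_le_qNumber_three hq
  have hd1 := (fusionSO3 q hq).one_le_d (n + 1)
  have hd : (2 * ((n + 1 : ℕ) : ℝ) + 1) * qNumber q 3 ≤ 3 * (fusionSO3 q hq).d (n + 1) :=
    mul_qNumber_three_le hq hq1 n
  have h1 := norm_rhoOp_fusionSO3_le hq (n + 1) ξ.1
  have h2 := norm_sub_norm_le (((fusionSO3 q hq).d (n + 1) : ℂ) • ξ.1)
    ((fusionSO3 q hq).rhoOp (n + 1) ξ.1)
  rw [norm_sub_rev, norm_smul, Complex.norm_real, Real.norm_of_nonneg (by linarith)] at h2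
  rw [ξ.2, mul_one] at h1 h2
  rw [le_div_iff₀ (by linarith)]
  have h4 : 2 * ((n + 1 : ℕ) : ℝ) + 1 ≤ 3 / qNumber q 3 * (fusionSO3 q hq).d (n + 1) := by
    rw [div_mul_eq_mul_div, le_div_iff₀ (by linarith)]
    exact hd
  linarith

/-- The test data are `X = {1}` and the normalized indicator; the error term is the end defect `4`
divided by the norm `√(N+2)` and by `d(1) = [3]_q`. -/
theorem kaz_rho_fusionSO3_le_add (N : ℕ) :
    (fusionSO3 q hq).Kaz (fusionSO3 q hq).rho ≤
      ((1 - 3 / qNumber q 3 + 4 / qNumber q 3 * (√((N + 2 : ℕ) : ℝ))⁻¹ : ℝ) : EReal) := by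
  set r : ℝ := √((N + 2 : ℕ) : ℝ) with hr
  have hr0 : 0 < r := Real.sqrt_pos.2 (by positivity)
  have hn : ‖((r⁻¹ : ℝ) : ℂ) • lpIndicator (N + 2)‖ = 1 := by
    rw [norm_smul, norm_lpIndicator, ← hr, Complex.norm_real, Real.norm_of_nonneg (by positivity),
      inv_mul_cancel₀ hr0.ne']
  refine (iInf_le _ ⟨{1}, generates_singleton_one hq⟩).trans ((iInf_le _ ⟨_, hn⟩).trans ?_)
  refine iSup₂_le fun a ha => ?_
  obtain rfl := Finset.mem_singleton.1 ha
  rw [EReal.coe_le_coe_iff, FusionAlgebra.rho_basis]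
  have h3 := three_le_qNumber_three hq
  have hd : (fusionSO3 q hq).d 1 = qNumber q 3 := rfl
  rw [hd, div_le_iff₀ (by linarith)]
  have h1 := norm_rhoOp_one_lpIndicator_sub_le hq N
  -- Inserting the approximate eigenvalue `3` splits the displacement into a small defect and a
  -- multiple of the unit vector of norm exactly `[3]_q - 3`.
  have h2 : (fusionSO3 q hq).rhoOp 1 (((r⁻¹ : ℝ) : ℂ) • lpIndicator (N + 2)) -
      (qNumber q 3 : ℂ) • ((r⁻¹ : ℝ) : ℂ) • lpIndicator (N + 2) =
      ((r⁻¹ : ℝ) : ℂ) • ((fusionSO3 q hq).rhoOp 1 (lpIndicator (N + 2)) -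
        (3 : ℂ) • lpIndicator (N + 2)) -
      ((qNumber q 3 - 3 : ℝ) : ℂ) • ((r⁻¹ : ℝ) : ℂ) • lpIndicator (N + 2) := by
    rw [map_smul]
    push_cast
    module
  rw [h2]
  refine (norm_sub_le _ _).trans ?_
  rw [norm_smul, norm_smul _ (_ • _), hn, Complex.norm_real, Complex.norm_real,
    Real.norm_of_nonneg (by positivity), Real.norm_of_nonneg (by linarith)]
  have h4 : r⁻¹ * ‖(fusionSO3 q hq).rhoOp 1 (lpIndicator (N + 2)) -
      (3 : ℂ) • lpIndicator (N + 2)‖ ≤ r⁻¹ * 4 := by gcongr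
  have h5 : (1 - 3 / qNumber q 3 + 4 / qNumber q 3 * r⁻¹) * qNumber q 3 =
      qNumber q 3 - 3 + r⁻¹ * 4 := by
    field_simp
  linarith

theorem kaz_rho_fusionSO3_le :
    (fusionSO3 q hq).Kaz (fusionSO3 q hq).rho ≤ ((1 - 3 / qNumber q 3 : ℝ) : EReal) := by
  refine ge_of_tendsto' (x := Filter.atTop) ?_ (kaz_rho_fusionSO3_le_add hq)
  refine (continuous_coe_real_ereal.tendsto _).comp ?_
  have h : Filter.Tendsto (fun N : ℕ => (√((N + 2 : ℕ) : ℝ))⁻¹) Filter.atTop (nhds 0) :=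
    (Real.tendsto_sqrt_atTop.comp (tendsto_natCast_atTop_atTop.comp
      (Filter.tendsto_add_atTop_nat 2))).inv_tendsto_atTop
  simpa using (h.const_mul (4 / qNumber q 3)).const_add (1 - 3 / qNumber q 3)

end RegularRepresentation

theorem mainTheorem6 (q : ℝ) (hq0 : 0 < q) (hq1 : q ≤ 1) :
    (fusionSO3 q hq0).Fix (fusionSO3 q hq0).rho = {0} ∧
    (fusionSO3 q hq0).Kaz (fusionSO3 q hq0).rho = ((1 - 3 / qNumber q 3 : ℝ) : EReal) ∧
    1 - 3 / qNumber q 3 = 1 - 3 / (q ^ (2 : ℤ) + q ^ (-2 : ℤ) + 1) := by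
  refine ⟨fix_rho_fusionSO3 hq0,
    le_antisymm (kaz_rho_fusionSO3_le hq0) (le_kaz_rho_fusionSO3 hq0 hq1), ?_⟩
  have h : q ^ (-2 : ℤ) = q⁻¹ ^ 2 := by
    rw [zpow_neg, inv_pow]
    rfl
  rw [qNumber_three hq0, h, add_comm 1]
  rfl
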